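/- For every $\beta\in(0,1)$ there is a constant $K>0$, depending only on $\beta$, such that the following holds. Let $c,d$ be positive real numbers and let $\mathcal G$ be a class of finite simple graphs, closed under isomorphism and under induced subgraphs, such that every $n$-vertex graph $G\in\mathcal G$ satisfies $|E(G)|\le d\,n$ (that is, has density $|E(G)|/n$ at most $d$ when $n\ge 1$) and has a $\frac12$-balanced separator of size at most $c\,n^{\beta}$, i.e. a set $X\subseteq V(G)$ with $|X|\le c\,n^\beta$ such that $G-X$ is the disjoint union of two (possibly empty) induced subgraphs, each with at most $n/2$ vertices and with no edge of $G$ between them. Then, for every $n$-vertex graph $G\in\mathcal G$, the forest polytope of $G$, that is, the convex hull in $\mathbb R^{E(G)}$ of the $0/1$ characteristic vectors of the edge sets of forests of $G$, has extension complexity at most $K\,c\,d\,n^{1+\beta}$. Here the extension complexity of a polytope $P\subseteq\mathbb R^N$ is the minimum number of inequalities in a linear system $Ax+By\le b,\ Cx+Dy=e$ (in variables $x\in\mathbb R^N$, $y\in\mathbb R^k$, for any $k$ and any number of equations) such that $P$ is the set of all $x$ for which there is a $y$ satisfying the system. -/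

import Mathlib

open scoped ENNReal

universe u

/-- A class of finite simple graphs, closed under isomorphism. -/
structure GraphClass where
  /-- Membership of a finite graph in the class. -/
  Mem : ∀ {V : Type u} [Finite V], SimpleGraph V → Prop
  mem_of_iso : ∀ {V W : Type u} [Finite V] [Finite W] {G : SimpleGraph V} {H : SimpleGraph W},
    Nonempty (G ≃g H) → Mem G → Mem H

/-- The class contains every induced subgraph of each of its members. -/
def GraphClass.ClosedUnderInduced (𝒢 : GraphClass.{u}) : Prop :=
  ∀ {V : Type u} [Finite V] (G : SimpleGraph V), 𝒢.Mem G → ∀ S : Set V, 𝒢.Mem (G.induce S)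

namespace SimpleGraph

/-- The density `|E(G)| / |V(G)|` of a finite graph (equal to `0` for the graph without vertices). -/
noncomputable def density {V : Type*} (G : SimpleGraph V) : ℝ :=
  (G.edgeSet.ncard : ℝ) / (Nat.card V : ℝ)

/-- `X` is an `α`-balanced separator of the finite graph `G`: the graph `G - X` is the disjoint
union of the subgraphs induced by `A` and `B`, each having at most `α |V(G)|` vertices. -/
def IsBalancedSeparator {V : Type*} (G : SimpleGraph V) (α : ℝ) (X : Set V) : Prop :=
  ∃ A B : Set V, A ∪ B = Xᶜ ∧ Disjoint A B ∧ (∀ a ∈ A, ∀ b ∈ B, ¬ G.Adj a b) ∧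
    (A.ncard : ℝ) ≤ α * (Nat.card V : ℝ) ∧ (B.ncard : ℝ) ≤ α * (Nat.card V : ℝ)

/-- The `0/1` characteristic vector in `ℝ^{E(G)}` of the edge set of `F`. -/
noncomputable def charVec {V : Type*} (G F : SimpleGraph V) : G.edgeSet → ℝ :=
  fun e => F.edgeSet.indicator (fun _ => (1 : ℝ)) (e : Sym2 V)

/-- The forest polytope of `G`: the convex hull in `ℝ^{E(G)}` of the characteristic vectors of the
forests of `G`. -/
def forestPolytope {V : Type*} (G : SimpleGraph V) : Set (G.edgeSet → ℝ) :=
  convexHull ℝ {x | ∃ F : SimpleGraph V, F ≤ G ∧ F.IsAcyclic ∧ x = G.charVec F}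

end SimpleGraph

/-- An extended formulation of a set `P` in a real vector space `E`: a linear system
`A x + B y ≤ b`, `C x + D y = c` with `y ∈ ℝ^k`, `m` inequalities and `p` equations, such that `P`
is the set of all `x` for which some `y` satisfies the system. (For `E = ℝ^ι` with `ι` finite,
the linear maps `A`, `B`, `C`, `D` are just matrices.) -/
structure ExtendedFormulation {E : Type*} [AddCommGroup E] [Module ℝ E] (P : Set E) where
  /-- number of additional variables -/
  k : ℕ
  /-- number of inequalities -/
  m : ℕ
  /-- number of equations -/
  p : ℕ
  A : E →ₗ[ℝ] (Fin m → ℝ)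
  B : (Fin k → ℝ) →ₗ[ℝ] (Fin m → ℝ)
  b : Fin m → ℝ
  C : E →ₗ[ℝ] (Fin p → ℝ)
  D : (Fin k → ℝ) →ₗ[ℝ] (Fin p → ℝ)
  c : Fin p → ℝ
  eq_setOf : P = {x | ∃ y : Fin k → ℝ, A x + B y ≤ b ∧ C x + D y = c}

/-- The size of an extended formulation is its number of inequalities. -/
def ExtendedFormulation.size {E : Type*} [AddCommGroup E] [Module ℝ E] {P : Set E}
    (F : ExtendedFormulation P) : ℕ :=
  F.m

/-- The extension complexity of `P`: the minimum size of an extended formulation of `P`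
(`⊤` if there is none). -/
noncomputable def extensionComplexity {E : Type*} [AddCommGroup E] [Module ℝ E] (P : Set E) : ℕ∞ :=
  ⨅ F : ExtendedFormulation P, (F.size : ℕ∞)

/-! By Edmonds' theorem (`mem_forestPolytope_of_forall_connected`) the forest polytope is cut out by
`x ≥ 0` and `x(E(S)) ≤ |S| - 1` for connected `S`. Fix `W` and a root `r ∈ W`, and split each `x e`
with `e` inside `W` between the two endpoints of `e`, so that `r` receives nothing and every other
vertex at most 1. Summing over the vertices of `S` yields the inequality for every `S ⊆ W`
containing `r` at once. Conversely, orienting a forest away from `r` gives such a splitting. The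
cost is `2|E(G[W])| + |W|` inequalities.

Few pairs `(W, r)` suffice (`exists_rooted_cover`): a connected `S ⊆ W` meets the separator `X` of
`W` or lies on one side of it. So take the pairs `(W, r)` with `r ∈ X`, of total size at most `c
|W|^(1+β)`, and recurse on both sides. Halving `W` twice over scales `|W|^(1+β)` by `2^(-β) < 1`, so
the levels form a geometric series. -/

/-! ### Extended formulations of convex hulls -/

/-- The projection of the solution set is convex, so feasibility need only be checked on the
generators `S`. -/
theorem extensionComplexity_convexHull_le {E κ μ π : Type*} [AddCommGroup E] [Module ℝ E]
    [Fintype κ] [Fintype μ] [Fintype π] {S : Set E}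
    (f : μ → E × (κ → ℝ) →ₗ[ℝ] ℝ) (b : μ → ℝ) (g : π → E × (κ → ℝ) →ₗ[ℝ] ℝ) (c : π → ℝ)
    (hS : ∀ x ∈ S, ∃ y, (∀ i, f i (x, y) ≤ b i) ∧ ∀ j, g j (x, y) = c j)
    (h : ∀ x y, (∀ i, f i (x, y) ≤ b i) → (∀ j, g j (x, y) = c j) → x ∈ convexHull ℝ S) :
    extensionComplexity (convexHull ℝ S) ≤ (Fintype.card μ : ℕ∞) := by
  have hconv : ∀ x ∈ convexHull ℝ S, ∃ y, (∀ i, f i (x, y) ≤ b i) ∧ ∀ j, g j (x, y) = c j := by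
    intro x hx
    refine convexHull_min (t := {x | ∃ y, (∀ i, f i (x, y) ≤ b i) ∧ ∀ j, g j (x, y) = c j})
      hS ?_ hx
    rintro x₁ ⟨y₁, h₁, h₁'⟩ x₂ ⟨y₂, h₂, h₂'⟩ s t hs ht hst
    refine ⟨s • y₁ + t • y₂, fun i => ?_, fun j => ?_⟩
    · have := add_le_add (mul_le_mul_of_nonneg_left (h₁ i) hs)
        (mul_le_mul_of_nonneg_left (h₂ i) ht)
      rw [← add_mul, hst, one_mul] at this
      rwa [← Prod.mk_add_mk, ← Prod.smul_mk, ← Prod.smul_mk, map_add, map_smul, map_smul]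
    · rw [← Prod.mk_add_mk, ← Prod.smul_mk, ← Prod.smul_mk, map_add, map_smul, map_smul, h₁', h₂',
        ← add_smul, hst, one_smul]
  let eκ := Fintype.equivFin κ
  let eμ := Fintype.equivFin μ
  let eπ := Fintype.equivFin π
  let R : (Fin (Fintype.card κ) → ℝ) →ₗ[ℝ] (κ → ℝ) := LinearMap.funLeft ℝ ℝ eκ
  let F : ExtendedFormulation (convexHull ℝ S) :=
    { k := Fintype.card κ
      m := Fintype.card μ
      p := Fintype.card π
      A := LinearMap.pi fun i => f (eμ.symm i) ∘ₗ LinearMap.inl ℝ E (κ → ℝ)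
      B := LinearMap.pi fun i => f (eμ.symm i) ∘ₗ LinearMap.inr ℝ E (κ → ℝ) ∘ₗ R
      b := b ∘ eμ.symm
      C := LinearMap.pi fun i => g (eπ.symm i) ∘ₗ LinearMap.inl ℝ E (κ → ℝ)
      D := LinearMap.pi fun i => g (eπ.symm i) ∘ₗ LinearMap.inr ℝ E (κ → ℝ) ∘ₗ R
      c := c ∘ eπ.symm
      eq_setOf := by
        have key : ∀ (φ : E × (κ → ℝ) →ₗ[ℝ] ℝ) x y, φ (x, 0) + φ (0, y) = φ (x, y) := by
          intro φ x y
          rw [← map_add]; simp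
        ext x
        constructor
        · intro hx
          obtain ⟨y, hy, hy'⟩ := hconv x hx
          refine ⟨y ∘ eκ.symm, ?_, ?_⟩
          · intro i
            have hR : R (y ∘ eκ.symm) = y := by ext; simp [R]
            simp [hR, key, hy]
          · ext i
            have hR : R (y ∘ eκ.symm) = y := by ext; simp [R]
            simp [hR, key, hy']
        · rintro ⟨y, hy, hy'⟩
          refine h x (R y) (fun i => ?_) (fun j => ?_)
          · simpa [key] using hy (eμ i)
          · simpa [key] using congrFun hy' (eπ j) }
  exact iInf_le_of_le F le_rfl

/-! ### Rooted forests and covers by separators -/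

namespace SimpleGraph

variable {V : Type*}

/-- Orient every edge away from the root of its component: a vertex then has at most one parent, and
a root has none. -/
theorem IsAcyclic.exists_injOn_head {F : SimpleGraph V} (hF : F.IsAcyclic) (r : V) :
    ∃ head : Sym2 V → V, (∀ e ∈ F.edgeSet, head e ∈ e ∧ head e ≠ r) ∧
      Set.InjOn head F.edgeSet := by
  classical
  have : Nonempty V := ⟨r⟩
  -- The component of `r` is rooted at `r` itself, so that `r` is never a head.
  let ρ : F.ConnectedComponent → V := Function.update Quot.out (F.connectedComponentMk r) r
  have hρ : ∀ v, F.Reachable (ρ (F.connectedComponentMk v)) v := by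
    intro v
    by_cases h : F.connectedComponentMk v = F.connectedComponentMk r
    · have : ρ (F.connectedComponentMk v) = r := by rw [h]; exact Function.update_self ..
      rw [this]
      exact (ConnectedComponent.exact h).symm
    · have : ρ (F.connectedComponentMk v) = Quot.out (F.connectedComponentMk v) :=
        Function.update_of_ne h ..
      rw [this]
      exact ConnectedComponent.exact (Quot.out_eq (F.connectedComponentMk v))
  let h : V → ℕ := fun v => F.dist (ρ (F.connectedComponentMk v)) v
  have key : ∀ e ∈ F.edgeSet, ∃ v u, e = s(u, v) ∧ h v = h u + 1 := by
    intro e he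
    induction e with | _ u v =>
    rw [mem_edgeSet] at he
    have hc : F.connectedComponentMk u = F.connectedComponentMk v :=
      ConnectedComponent.sound he.reachable
    have := hF.dist_eq_dist_add_one_of_adj_of_reachable (u := ρ (F.connectedComponentMk u)) he
      (hρ u)
    rcases this with h' | h'
    · exact ⟨u, v, Sym2.eq_swap, by simpa [h, ← hc] using h'⟩
    · exact ⟨v, u, rfl, by simpa [h, ← hc] using h'⟩
  choose! head tail hht using key
  refine ⟨head, fun e he => ⟨?_, ?_⟩, ?_⟩
  · obtain ⟨h1, -⟩ := hht e he
    exact Sym2.mem_iff_exists.2 ⟨tail e, h1.trans Sym2.eq_swap⟩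
  · obtain ⟨-, h2⟩ := hht e he
    intro hr
    rw [hr] at h2
    have hρr : ρ (F.connectedComponentMk r) = r := Function.update_self ..
    have : h r = 0 := by simp only [h, hρr, dist_self]
    omega
  · intro e he e' he' hee
    obtain ⟨h1, h2⟩ := hht e he
    obtain ⟨h1', h2'⟩ := hht e' he'
    -- Paths in a forest are unique, so the parent of `v` is the penultimate vertex of any path from
    -- the root to `v`.
    have main : ∀ u v (huv : F.Adj u v), h v = h u + 1 →
        ∀ q : F.Walk (ρ (F.connectedComponentMk v)) v, q.IsPath → u = q.penultimate := by
      intro u v huv hd q hq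
      have hc : F.connectedComponentMk u = F.connectedComponentMk v :=
        ConnectedComponent.sound huv.reachable
      obtain ⟨p, hp⟩ := (hρ u).exists_walk_length_eq_dist
      have hp' : ((p.concat huv).copy (congrArg ρ hc) rfl).IsPath := by
        apply Walk.isPath_of_length_eq_dist
        simpa [hp] using hd.symm
      have := congrArg Subtype.val ((hF.subsingleton_path _ _).elim ⟨_, hp'⟩ ⟨q, hq⟩)
      change _ = q at this
      rw [← this]
      simp [Walk.concat_eq_append, Walk.getVert_append]
    have hadj : F.Adj (tail e) (head e) := by rwa [← mem_edgeSet, ← h1]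
    have hadj' : F.Adj (tail e') (head e) := by rwa [hee, ← mem_edgeSet, ← h1']
    obtain ⟨q, hq⟩ := (hρ (head e)).exists_isPath
    have ht := (main _ _ hadj h2 q hq).trans (main _ _ hadj' (by rw [hee, h2']) q hq).symm
    rw [h1, h1', ht, hee]

theorem subset_or_subset_of_connected_induce {G : SimpleGraph V} {S A B : Set V}
    (hS : (G.induce S).Connected) (hAB : S ⊆ A ∪ B) (hadj : ∀ a ∈ A, ∀ b ∈ B, ¬ G.Adj a b) :
    S ⊆ A ∨ S ⊆ B := by
  by_contra! hcon
  obtain ⟨⟨s, hs, hsA⟩, ⟨t, ht, htB⟩⟩ := hcon.imp Set.not_subset.1 Set.not_subset.1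
  have hsB := (hAB hs).resolve_left hsA
  have key : ∀ x y : S, (G.induce S).Walk x y → (y : V) ∉ B → (x : V) ∉ B := by
    intro x y p hy
    induction p with
    | nil => exact hy
    | @cons u v w huv p ih =>
      intro hu
      have hv := (hAB v.2).resolve_right (ih hy)
      exact hadj _ hv _ hu (G.adj_symm huv)
  obtain ⟨p⟩ := hS.preconnected ⟨s, hs⟩ ⟨t, ht⟩
  exact key _ _ p htB hsB

/-- A recursive use of balanced separators yields few pairs `(W, r)`, of small total size, such
that every connected vertex set lies in one of the sets `W` and contains the vertex `r`. -/
theorem exists_rooted_cover [Finite V] {G : SimpleGraph V} {c β : ℝ} (hc : 0 ≤ c) (hβ : 0 < β)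
    (hsep : ∀ W : Set V, ∃ X : Set W, (G.induce W).IsBalancedSeparator (1 / 2) X ∧
      (X.ncard : ℝ) ≤ c * (Nat.card W : ℝ) ^ β) (W : Finset V) :
    ∃ L : Finset (Finset V × V),
      (∀ S : Finset V, S ⊆ W → (G.induce (S : Set V)).Connected → ∃ p ∈ L, S ⊆ p.1 ∧ p.2 ∈ S) ∧
      ∑ p ∈ L, (p.1.card : ℝ) ≤ c / (1 - 2 ^ (-β)) * (W.card : ℝ) ^ (1 + β) := by
  classical
  have h2 : (2 : ℝ) ^ (-β) < 1 := Real.rpow_lt_one_of_one_lt_of_neg one_lt_two (by linarith)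
  have h2' : (0 : ℝ) < 1 - 2 ^ (-β) := by linarith
  induction hn : W.card using Nat.strong_induction_on generalizing W with | _ n ih =>
  subst hn
  rcases W.eq_empty_or_nonempty with rfl | hW
  · refine ⟨∅, fun S hS hconn => ?_, ?_⟩
    · obtain ⟨x⟩ := hconn.nonempty
      exact absurd (hS x.2) (Finset.notMem_empty _)
    · simp [Real.zero_rpow (show 1 + β ≠ 0 by linarith)]
  have hpos : 0 < W.card := hW.card_pos
  have hposR : (0 : ℝ) < W.card := by exact_mod_cast hpos
  obtain ⟨X, ⟨A, B, hAB, -, hadj, hA, hB⟩, hX⟩ := hsep W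
  have hcard : Nat.card (W : Set V) = W.card := by simp
  rw [hcard] at hX hA hB
  have : Fintype V := Fintype.ofFinite V
  have htr : ∀ Y : Set (W : Set V), ∃ Z : Finset V, (Z : Set V) = Subtype.val '' Y ∧
      Z.card = Y.ncard := by
    intro Y
    refine ⟨(Subtype.val '' Y).toFinset, by simp, ?_⟩
    rw [← Set.ncard_eq_toFinset_card', Set.ncard_image_of_injective _ Subtype.val_injective]
  obtain ⟨X', hX', hXc⟩ := htr X
  obtain ⟨A', hA', hAc⟩ := htr A
  obtain ⟨B', hB', hBc⟩ := htr B
  rw [← hXc] at hX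
  rw [← hAc] at hA
  rw [← hBc] at hB
  -- `(n/2)^(1+β) = (2^(-β)/2) n^(1+β)`: the two sides together cost a fraction `2^(-β)` of the
  -- bound for `W`.
  have hpow : ∀ a : ℕ, (a : ℝ) ≤ 1 / 2 * W.card →
      c / (1 - 2 ^ (-β)) * (a : ℝ) ^ (1 + β) ≤
        c / (1 - 2 ^ (-β)) * (2 ^ (-β) / 2 * (W.card : ℝ) ^ (1 + β)) := by
    intro a ha
    refine mul_le_mul_of_nonneg_left ?_ (by positivity)
    refine (Real.rpow_le_rpow (by positivity) ha (by linarith)).trans_eq ?_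
    rw [Real.mul_rpow (by norm_num) hposR.le, one_div, Real.inv_rpow (by norm_num),
      Real.rpow_add two_pos, Real.rpow_one, Real.rpow_neg two_pos.le]
    field_simp
  have hlt : ∀ a : ℕ, (a : ℝ) ≤ 1 / 2 * W.card → a < W.card := by
    intro a ha
    have : (a : ℝ) < W.card := by linarith
    exact_mod_cast this
  obtain ⟨LA, hLA, hLA'⟩ := ih _ (hlt _ hA) A' rfl
  obtain ⟨LB, hLB, hLB'⟩ := ih _ (hlt _ hB) B' rfl
  refine ⟨X'.image (fun x => (W, x)) ∪ (LA ∪ LB), fun S hS hconn => ?_, ?_⟩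
  · by_cases hSX : ∃ x ∈ X', x ∈ S
    · obtain ⟨x, hx, hxS⟩ := hSX
      exact ⟨(W, x), by simp [hx], hS, hxS⟩
    · push Not at hSX
      have hsub : (S : Set V) ⊆ A' ∪ B' := by
        intro v hv
        have hvW := hS hv
        have hvX : (⟨v, hvW⟩ : (W : Set V)) ∈ Xᶜ := by
          intro h
          exact hSX v (by rw [← Finset.mem_coe, hX']; exact ⟨_, h, rfl⟩) hv
        rw [← hAB] at hvX
        rw [hA', hB', ← Set.image_union]
        exact ⟨_, hvX, rfl⟩
      have hadj' : ∀ a ∈ (A' : Set V), ∀ b ∈ (B' : Set V), ¬ G.Adj a b := by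
        rw [hA', hB']
        rintro _ ⟨a, ha, rfl⟩ _ ⟨b, hb, rfl⟩ h
        exact hadj a ha b hb h
      rcases subset_or_subset_of_connected_induce hconn hsub hadj' with h | h
      · obtain ⟨p, hp, hp'⟩ := hLA S (Finset.coe_subset.1 h) hconn
        exact ⟨p, by simp [hp], hp'⟩
      · obtain ⟨p, hp, hp'⟩ := hLB S (Finset.coe_subset.1 h) hconn
        exact ⟨p, by simp [hp], hp'⟩
  · have hunion : ∀ s t : Finset (Finset V × V), ∑ p ∈ s ∪ t, (p.1.card : ℝ) ≤
        ∑ p ∈ s, (p.1.card : ℝ) + ∑ p ∈ t, (p.1.card : ℝ) := by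
      intro s t
      rw [← Finset.sum_union_inter]
      exact le_add_of_nonneg_right (Finset.sum_nonneg fun _ _ => by positivity)
    have hroot : ∑ p ∈ X'.image (fun x => (W, x)), (p.1.card : ℝ) ≤
        c * (W.card : ℝ) ^ (1 + β) := by
      rw [Finset.sum_image (by simp)]
      simp only [Finset.sum_const, nsmul_eq_mul]
      refine (mul_le_mul_of_nonneg_right hX hposR.le).trans_eq ?_
      rw [Real.rpow_add hposR, Real.rpow_one]
      ring
    have e1 := hunion (X'.image (fun x => (W, x))) (LA ∪ LB)
    have e2 := hunion LA LB
    have e3 := hLA'.trans (hpow _ hA)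
    have e4 := hLB'.trans (hpow _ hB)
    -- The constant `M = c / (1 - 2^(-β))` is the solution of `c + 2^(-β) M = M`.
    have e5 : c * (W.card : ℝ) ^ (1 + β) +
        (c / (1 - 2 ^ (-β)) * (2 ^ (-β) / 2 * (W.card : ℝ) ^ (1 + β)) +
          c / (1 - 2 ^ (-β)) * (2 ^ (-β) / 2 * (W.card : ℝ) ^ (1 + β))) =
        c / (1 - 2 ^ (-β)) * (W.card : ℝ) ^ (1 + β) := by
      field_simp
      ring
    linarith

end SimpleGraph

/-! ### Rank inequalities and Edmonds' theorem -/

/-- The positive part of `w` is a nonnegative combination of indicators of its superlevel sets; the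
induction peels off the smallest positive value. -/
theorem Finset.sum_mul_nonpos_of_sum_superlevel_nonpos {ι : Type*} [Fintype ι] (w a : ι → ℝ)
    (h : ∀ i, 0 < w i → ∑ j with w i ≤ w j, a j ≤ 0) : ∑ i with 0 < w i, w i * a i ≤ 0 := by
  classical
  induction hn : (Finset.univ.filter fun i => 0 < w i).card using Nat.strong_induction_on
    generalizing w with | _ n ih =>
  rcases (Finset.univ.filter fun i => 0 < w i).eq_empty_or_nonempty with he | hne
  · simp [he]
  obtain ⟨i, hi, hmin⟩ := Finset.exists_min_image _ w hne
  simp only [Finset.mem_filter, Finset.mem_univ, true_and] at hi hmin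
  have hsub : (Finset.univ.filter fun j => 0 < w j - w i) ⊆
      Finset.univ.filter fun j => 0 < w j := by
    intro j
    simp only [Finset.mem_filter, Finset.mem_univ, true_and]
    intro hj
    linarith
  have hlt : (Finset.univ.filter fun j => 0 < w j - w i).card < n := by
    rw [← hn]
    refine Finset.card_lt_card (Finset.ssubset_iff_subset_ne.2 ⟨hsub, fun heq => ?_⟩)
    have : i ∈ Finset.univ.filter fun j => 0 < w j - w i := by rw [heq]; simpa using hi
    simp at this
  have hrec := ih _ hlt (fun j => w j - w i) (fun j hj => by
    simpa using h j (by linarith)) rfl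
  have hsplit : ∑ j with 0 < w j, w j * a j =
      ∑ j with 0 < w j, (w j - w i) * a j + w i * ∑ j with 0 < w j, a j := by
    rw [Finset.mul_sum, ← Finset.sum_add_distrib]
    exact Finset.sum_congr rfl fun j _ => by ring
  have hshift : ∑ j with 0 < w j - w i, (w j - w i) * a j =
      ∑ j with 0 < w j, (w j - w i) * a j := by
    refine Finset.sum_subset hsub fun j hj hj' => ?_
    simp only [Finset.mem_filter, Finset.mem_univ, true_and] at hj hj'
    have := hmin j hj
    rw [show w j - w i = 0 by linarith, zero_mul]
  have hlevel : (Finset.univ.filter fun j => w i ≤ w j) = Finset.univ.filter fun j => 0 < w j := by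
    ext j
    simp only [Finset.mem_filter, Finset.mem_univ, true_and]
    exact ⟨fun h => hi.trans_le h, hmin j⟩
  have hi' := h i hi
  rw [hlevel] at hi'
  rw [hsplit, ← hshift]
  have := mul_nonpos_of_nonneg_of_nonpos hi.le hi'
  linarith

namespace SimpleGraph

variable {V : Type*}

theorem card_supp_le_card_filter_edges [Finite V] (F : SimpleGraph V) [Fintype F.edgeSet]
    [DecidableEq F.ConnectedComponent] (C : F.ConnectedComponent) :
    Nat.card C.supp ≤
      (F.edgeFinset.filter fun e => F.connectedComponentMk e.out.1 = C).card + 1 := by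
  classical
  have : Fintype V := Fintype.ofFinite V
  refine C.connected_toSimpleGraph.card_vert_le_card_edgeSet_add_one.trans
    (Nat.add_le_add_right ?_ 1)
  rw [Nat.card_eq_fintype_card, ← Set.toFinset_card]
  refine Finset.card_le_card_of_injOn (Sym2.map Subtype.val) ?_
    (Sym2.map.injective Subtype.val_injective).injOn
  intro e he
  have he : e ∈ C.toSimpleGraph.edgeSet := by simpa using he
  have hmem : Sym2.map Subtype.val e ∈ F.edgeSet := by
    induction e with | _ x y => exact he
  have hout := Sym2.out_fst_mem (Sym2.map Subtype.val e)
  rw [Sym2.mem_map] at hout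
  obtain ⟨v, -, hv⟩ := hout
  simp only [Finset.coe_filter, mem_edgeFinset, Set.mem_ofPred_eq]
  refine ⟨hmem, ?_⟩
  rw [← hv]
  exact v.2

/-- The rank inequality for a graph `H ≤ G`, of which `F` is a spanning subgraph. -/
theorem sum_edges_le_card_of_reachable_eq [Finite V] {G H F : SimpleGraph V} [Fintype G.edgeSet]
    [Fintype F.edgeSet] (hFG : F ≤ G) (hF : F.Reachable = H.Reachable) {x : G.edgeSet → ℝ}
    [DecidablePred fun e : G.edgeSet => (e : Sym2 V) ∈ H.edgeSet]
    [∀ S : Finset V, DecidablePred fun e : G.edgeSet => ∀ v ∈ (e : Sym2 V), v ∈ S]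
    (h0 : ∀ e, 0 ≤ x e)
    (hx : ∀ S : Finset V, (G.induce (S : Set V)).Connected →
      ∑ e ∈ Finset.univ.filter (fun e : G.edgeSet => ∀ v ∈ (e : Sym2 V), v ∈ S), x e ≤ S.card - 1) :
    ∑ e ∈ Finset.univ.filter (fun e : G.edgeSet => (e : Sym2 V) ∈ H.edgeSet), x e ≤
      (F.edgeFinset.card : ℝ) := by
  classical
  have : Fintype V := Fintype.ofFinite V
  have : Fintype F.ConnectedComponent := Fintype.ofFinite _
  -- One arbitrary endpoint assigns an edge to a component. For edges of `H` the choice is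
  -- immaterial, as `F` and `H` have the same reachability.
  let comp : Sym2 V → F.ConnectedComponent := fun e => F.connectedComponentMk e.out.1
  rw [Finset.card_eq_sum_card_fiberwise (f := comp) (t := Finset.univ) (by simp),
    ← Finset.sum_fiberwise _ (fun e : G.edgeSet => comp e)]
  push_cast
  refine Finset.sum_le_sum fun C _ => ?_
  have hconn : (G.induce (C.supp.toFinset : Set V)).Connected := by
    rw [Set.coe_toFinset]
    exact C.connected_toSimpleGraph.mono (fun _ _ h => hFG h)
  have h1 := card_supp_le_card_filter_edges F C
  have h2 := hx C.supp.toFinset hconn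
  rw [Set.toFinset_card, ← Nat.card_eq_fintype_card] at h2
  have h1' : (Nat.card C.supp : ℝ) ≤
      (F.edgeFinset.filter fun e => F.connectedComponentMk e.out.1 = C).card + 1 := by
    exact_mod_cast h1
  have h3 : ∑ e ∈ (Finset.univ.filter fun e : G.edgeSet => (e : Sym2 V) ∈ H.edgeSet).filter
      (fun e : G.edgeSet => comp e = C), x e ≤
      ∑ e ∈ Finset.univ.filter (fun e : G.edgeSet => ∀ v ∈ (e : Sym2 V), v ∈ C.supp.toFinset), x e := by
    refine Finset.sum_le_sum_of_subset_of_nonneg ?_ fun e _ _ => h0 e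
    intro e he
    simp only [Finset.mem_filter, Finset.mem_univ, true_and, Set.mem_toFinset] at he ⊢
    obtain ⟨heH, heC⟩ := he
    intro v hv
    rw [ConnectedComponent.mem_supp_iff, ← heC]
    refine ConnectedComponent.sound ?_
    rw [hF]
    obtain ⟨w, hw⟩ := Sym2.mem_iff_exists.1 hv
    have hout := Sym2.out_fst_mem (e : Sym2 V)
    rw [hw, mem_edgeSet] at heH
    rw [hw, Sym2.mem_iff] at hout
    rcases hout with h | h
    · rw [hw, h]
    · rw [hw, h]; exact heH.reachable
  simp only [comp] at h3 ⊢
  linarith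

/-- The subgraph of the edges of `G` whose weight is at least `t`. -/
def superlevel (G : SimpleGraph V) (w : Sym2 V → ℝ) (t : ℝ) : SimpleGraph V :=
  fromEdgeSet {e | e ∈ G.edgeSet ∧ t ≤ w e}

theorem edgeSet_superlevel (G : SimpleGraph V) (w : Sym2 V → ℝ) (t : ℝ) :
    (G.superlevel w t).edgeSet = {e | e ∈ G.edgeSet ∧ t ≤ w e} := by
  rw [superlevel, edgeSet_fromEdgeSet, sdiff_eq_left]
  exact Set.disjoint_left.2 fun e he hd => G.not_isDiag_of_mem_edgeSet he.1 hd

/-- A forest that spans each of finitely many superlevel graphs, as Kruskal's algorithm builds. -/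
theorem exists_isAcyclic_superlevel_reachable_eq (G : SimpleGraph V) (w : Sym2 V → ℝ)
    (T : Finset ℝ) : ∃ F : SimpleGraph V, F.IsAcyclic ∧
      (∀ e ∈ F.edgeSet, e ∈ G.edgeSet ∧ ∃ t ∈ T, t ≤ w e) ∧
      ∀ t ∈ T, (F ⊓ G.superlevel w t).Reachable = (G.superlevel w t).Reachable := by
  induction T using Finset.induction_on_min with
  | empty => exact ⟨⊥, isAcyclic_bot, by simp, by simp⟩
  | insert a T ha ih =>
    obtain ⟨F, hF, hFT, hFr⟩ := ih
    have hle : F ≤ G.superlevel w a := by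
      rw [← edgeSet_subset_edgeSet, edgeSet_superlevel]
      intro e he
      obtain ⟨heG, t, ht, hte⟩ := hFT e he
      exact ⟨heG, (ha t ht).le.trans hte⟩
    -- Thresholds are added in decreasing order, so `F` only grows and the higher levels stay
    -- spanned.
    obtain ⟨F', hFF', hF'le, hF', hr⟩ := exists_isAcyclic_reachable_eq_le_of_le_of_isAcyclic hle hF
    refine ⟨F', hF', fun e he => ?_, fun t ht => ?_⟩
    · have := edgeSet_mono hF'le he
      rw [edgeSet_superlevel] at this
      exact ⟨this.1, a, Finset.mem_insert_self _ _, this.2⟩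
    · rcases Finset.mem_insert.1 ht with rfl | ht
      · rwa [inf_eq_left.2 hF'le]
      · ext u v
        refine ⟨fun h => h.mono inf_le_right, fun h => ?_⟩
        rw [← hFr t ht] at h
        exact h.mono (inf_le_inf_right _ hFF')

/-- Edmonds' theorem for the graphic matroid: the rank inequalities describe the forest
polytope. -/
theorem mem_forestPolytope_of_forall_connected [Finite V] {G : SimpleGraph V} [Fintype G.edgeSet]
    {x : G.edgeSet → ℝ} (h0 : ∀ e, 0 ≤ x e)
    [∀ S : Finset V, DecidablePred fun e : G.edgeSet => ∀ v ∈ (e : Sym2 V), v ∈ S]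
    (hx : ∀ S : Finset V, (G.induce (S : Set V)).Connected →
      ∑ e ∈ Finset.univ.filter (fun e : G.edgeSet => ∀ v ∈ (e : Sym2 V), v ∈ S), x e ≤ S.card - 1) :
    x ∈ G.forestPolytope := by
  classical
  have : Fintype V := Fintype.ofFinite V
  by_contra hcon
  have hfin : {x | ∃ F : SimpleGraph V, F ≤ G ∧ F.IsAcyclic ∧ x = G.charVec F}.Finite := by
    refine (Set.finite_range (G.charVec)).subset ?_
    rintro _ ⟨F, -, -, rfl⟩
    exact ⟨F, rfl⟩
  -- A separating functional is a weight `w` under which `x` beats every forest; the greedy forest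
  -- for the positive weights refutes this.
  obtain ⟨f, u, hfu, hux⟩ := geometric_hahn_banach_closed_point (convex_convexHull ℝ _)
    (hfin.isClosed_convexHull ℝ) hcon
  let w : Sym2 V → ℝ := fun e => if h : e ∈ G.edgeSet then f (Pi.single ⟨e, h⟩ 1) else 0
  have hf : ∀ y : G.edgeSet → ℝ, f y = ∑ e : G.edgeSet, w e * y e := by
    intro y
    conv_lhs => rw [pi_eq_sum_univ' y, map_sum]
    refine Finset.sum_congr rfl fun e _ => ?_
    rw [map_smul, smul_eq_mul, mul_comm]
    simp only [w, e.2, dif_pos]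
  obtain ⟨F, hF, hFT, hFr⟩ := G.exists_isAcyclic_superlevel_reachable_eq w
    ((Finset.univ.filter fun e : G.edgeSet => 0 < w e).image fun e : G.edgeSet => w e)
  have hFG : F ≤ G := by
    rw [← edgeSet_subset_edgeSet]
    exact fun e he => (hFT e he).1
  have hFw : ∀ e ∈ F.edgeSet, 0 < w e := by
    intro e he
    obtain ⟨-, t, ht, hte⟩ := hFT e he
    simp only [Finset.mem_image, Finset.mem_filter, Finset.mem_univ, true_and] at ht
    obtain ⟨e', he', rfl⟩ := ht
    exact he'.trans_le hte
  -- At each positive level `F` has as many edges as the rank allows, and `x` has no more mass than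
  -- that.
  have key := Finset.sum_mul_nonpos_of_sum_superlevel_nonpos (fun e : G.edgeSet => w e)
    (fun e => x e - G.charVec F e) (fun e he => by
      have hr := hFr (w e) (Finset.mem_image.2 ⟨e, by simpa using he, rfl⟩)
      have h := sum_edges_le_card_of_reachable_eq (inf_le_left.trans hFG) hr h0 hx
      have hfilt : (Finset.univ.filter fun e' : G.edgeSet =>
          (e' : Sym2 V) ∈ (G.superlevel w (w e)).edgeSet) =
          Finset.univ.filter fun e' : G.edgeSet => w e ≤ w e' := by
        ext e'
        simp [edgeSet_superlevel]
      have hcard : ((F ⊓ G.superlevel w (w e)).edgeFinset.card : ℝ) =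
          ∑ e' ∈ Finset.univ.filter (fun e' : G.edgeSet => w e ≤ w e'), G.charVec F e' := by
        simp only [charVec, Set.indicator_apply, Finset.sum_boole, Nat.cast_inj]
        symm
        refine Finset.card_bij (fun (e' : G.edgeSet) _ => (e' : Sym2 V)) ?_ ?_ ?_
        · intro e' he'
          simpa [edgeSet_superlevel, and_comm] using he'
        · exact fun _ _ _ _ h => Subtype.ext h
        · intro e' he'
          simp only [mem_edgeFinset, edgeSet_inf, edgeSet_superlevel] at he'
          exact ⟨⟨e', he'.2.1⟩, by simpa using ⟨he'.2.2, he'.1⟩, rfl⟩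
      rw [hfilt, hcard] at h
      rw [Finset.sum_sub_distrib]
      linarith)
  have h1 : f (G.charVec F) =
      ∑ e ∈ Finset.univ.filter (fun e : G.edgeSet => 0 < w e), w e * G.charVec F e := by
    rw [hf]
    refine (Finset.sum_subset (Finset.subset_univ _) fun e _ he => ?_).symm
    rw [charVec, Set.indicator_of_notMem, mul_zero]
    intro heF
    exact he (by simpa using hFw _ heF)
  have h2 : f x ≤ ∑ e ∈ Finset.univ.filter (fun e : G.edgeSet => 0 < w e), w e * x e := by
    rw [hf, ← Finset.sum_filter_add_sum_filter_not Finset.univ fun e : G.edgeSet => 0 < w e]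
    refine add_le_of_nonpos_right (Finset.sum_nonpos fun e he => ?_)
    simp only [Finset.mem_filter, Finset.mem_univ, true_and, not_lt] at he
    exact mul_nonpos_of_nonpos_of_nonneg he (h0 e)
  have h3 := hfu _ (subset_convexHull ℝ _ ⟨F, hFG, hF, rfl⟩)
  simp only [mul_sub, Finset.sum_sub_distrib] at key
  linarith

/-! ### The extended formulation -/

/-- The extended formulation orients the forest, for each pair `(W, r)`, away from `r`: the variable
indexed by `(p, e, v)` says that `v` is the head of `e`. -/
theorem extensionComplexity_forestPolytope_le [Fintype V] [DecidableEq V] (G : SimpleGraph V)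
    [Fintype G.edgeSet]
    [∀ S : Finset V, DecidablePred fun e : G.edgeSet => ∀ v ∈ (e : Sym2 V), v ∈ S]
    (L : Finset (Finset V × V))
    (hL : ∀ S : Finset V, (G.induce (S : Set V)).Connected →
      (∃ e : G.edgeSet, ∀ v ∈ (e : Sym2 V), v ∈ S) → ∃ p ∈ L, S ⊆ p.1 ∧ p.2 ∈ S) :
    extensionComplexity G.forestPolytope ≤
      ((∑ p ∈ L, (2 * (Finset.univ.filter fun e : G.edgeSet =>
        ∀ v ∈ (e : Sym2 V), v ∈ p.1).card + p.1.card) : ℕ) : ℕ∞) := by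
  classical
  -- `μ₁` indexes nonnegativity, `μ₂` the in-degree bounds, `π` the splitting equations. Only
  -- inequalities count, so superfluous variables in `κ` are free.
  let κ := L × G.edgeSet × V
  let μ₁ := Σ p : L, Σ e : {e : G.edgeSet // ∀ v ∈ (e : Sym2 V), v ∈ p.1.1},
    {v : V // v ∈ (e.1 : Sym2 V)}
  let μ₂ := Σ p : L, {v : V // v ∈ p.1.1}
  let π := Σ p : L, {e : G.edgeSet // ∀ v ∈ (e : Sym2 V), v ∈ p.1.1}
  let pr : κ → (G.edgeSet → ℝ) × (κ → ℝ) →ₗ[ℝ] ℝ := fun q =>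
    LinearMap.proj q ∘ₗ LinearMap.snd ℝ (G.edgeSet → ℝ) (κ → ℝ)
  have hcard : Fintype.card (μ₁ ⊕ μ₂) = ∑ p ∈ L, (2 * (Finset.univ.filter fun e : G.edgeSet =>
        ∀ v ∈ (e : Sym2 V), v ∈ p.1).card + p.1.card) := by
    have h2 : ∀ e : G.edgeSet, Fintype.card {v : V // v ∈ (e : Sym2 V)} = 2 := by
      intro e
      rw [Fintype.card_subtype,
        ← Sym2.card_toFinset_of_not_isDiag _ (G.not_isDiag_of_mem_edgeSet e.2)]
      congr 1
      ext v
      simp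
    rw [Fintype.card_sum, Fintype.card_sigma, Fintype.card_sigma, ← Finset.sum_add_distrib,
      ← Finset.sum_coe_sort L]
    refine Finset.sum_congr rfl fun p _ => ?_
    rw [Fintype.card_sigma, Finset.sum_congr rfl fun e _ => h2 e.1]
    simp [Fintype.card_subtype, mul_comm]
  rw [← hcard]
  refine extensionComplexity_convexHull_le (κ := κ) (μ := μ₁ ⊕ μ₂) (π := π)
    (Sum.elim (fun i => - pr (i.1, i.2.1.1, i.2.2.1)) (fun i =>
      ∑ e ∈ Finset.univ.filter (fun e : G.edgeSet =>
        (∀ v ∈ (e : Sym2 V), v ∈ i.1.1.1) ∧ i.2.1 ∈ (e : Sym2 V)), pr (i.1, e, i.2.1)))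
    (Sum.elim (fun _ => 0) (fun i => if i.2.1 = i.1.1.2 then 0 else 1))
    (fun i => LinearMap.proj i.2.1 ∘ₗ LinearMap.fst ℝ (G.edgeSet → ℝ) (κ → ℝ) -
      ∑ v ∈ Finset.univ.filter (fun v => v ∈ (i.2.1 : Sym2 V)), pr (i.1, i.2.1, v))
    (fun _ => 0) ?_ ?_
  · rintro _ ⟨F, hFG, hF, rfl⟩
    choose head hhead hinj using fun r => hF.exists_injOn_head (r := r)
    refine ⟨fun q => if (q.2.1 : Sym2 V) ∈ F.edgeSet ∧ head q.1.1.2 q.2.1 = q.2.2 then 1 else 0,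
      ?_, ?_⟩
    · rintro (i | i)
      · simp only [Sum.elim_inl, LinearMap.neg_apply, pr, LinearMap.comp_apply,
          LinearMap.snd_apply, LinearMap.proj_apply]
        split_ifs <;> norm_num
      · simp only [Sum.elim_inr, LinearMap.sum_apply, pr, LinearMap.comp_apply,
          LinearMap.snd_apply, LinearMap.proj_apply, Finset.sum_boole]
        split_ifs with hr
        · norm_cast
          rw [Nat.le_zero, Finset.card_eq_zero, Finset.filter_eq_empty_iff]
          rintro e - ⟨heF, he⟩
          exact (hhead _ e heF).2 (he.trans hr)
        · norm_cast
          rw [Finset.card_le_one]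
          intro e he e' he'
          simp only [Finset.mem_filter] at he he'
          exact Subtype.ext (hinj _ he.2.1 he'.2.1 (he.2.2.trans he'.2.2.symm))
    · intro i
      simp only [LinearMap.sub_apply, LinearMap.sum_apply, pr, LinearMap.comp_apply,
        LinearMap.snd_apply, LinearMap.fst_apply, LinearMap.proj_apply, charVec,
        Set.indicator_apply, sub_eq_zero]
      by_cases heF : (i.2.1 : Sym2 V) ∈ F.edgeSet
      · simp [heF, (hhead i.1.1.2 _ heF).1]
      · simp [heF]
  · intro x y hle heq
    have hnonneg : ∀ (p : L) (e : G.edgeSet), (∀ v ∈ (e : Sym2 V), v ∈ p.1.1) →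
        ∀ v ∈ (e : Sym2 V), 0 ≤ y (p, e, v) := by
      intro p e he v hv
      simpa [pr] using hle (Sum.inl ⟨p, ⟨e, he⟩, ⟨v, hv⟩⟩)
    have hdeg : ∀ (p : L), ∀ v ∈ p.1.1, ∑ e ∈ Finset.univ.filter (fun e : G.edgeSet =>
        (∀ v ∈ (e : Sym2 V), v ∈ p.1.1) ∧ v ∈ (e : Sym2 V)), y (p, e, v) ≤
        if v = p.1.2 then 0 else 1 := by
      intro p v hv
      simpa [pr] using hle (Sum.inr ⟨p, ⟨v, hv⟩⟩)
    have hsum : ∀ (p : L) (e : G.edgeSet), (∀ v ∈ (e : Sym2 V), v ∈ p.1.1) →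
        x e = ∑ v ∈ Finset.univ.filter (fun v => v ∈ (e : Sym2 V)), y (p, e, v) := by
      intro p e he
      simpa [pr, sub_eq_zero] using heq ⟨p, ⟨e, he⟩⟩
    refine mem_forestPolytope_of_forall_connected (fun e => ?_) fun S hS => ?_
    -- Nonnegativity of `x e` is inherited from a pair covering the connected set of the two
    -- endpoints of `e`.
    · obtain ⟨u, v, he⟩ : ∃ u v, (e : Sym2 V) = s(u, v) := by
        induction h : (e : Sym2 V) with | _ u v => exact ⟨u, v, rfl⟩
      have hadj : G.Adj u v := by rw [← mem_edgeSet, ← he]; exact e.2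
      obtain ⟨p, hp, hSp, -⟩ := hL {u, v} (by
        rw [Finset.coe_pair]
        exact induce_pair_connected_of_adj hadj) ⟨e, by simp [he]⟩
      have hin : ∀ w ∈ (e : Sym2 V), w ∈ p.1 := by
        intro w hw
        rw [he, Sym2.mem_iff] at hw
        exact hSp (by simpa using hw)
      rw [hsum ⟨p, hp⟩ e hin]
      exact Finset.sum_nonneg fun w hw => hnonneg ⟨p, hp⟩ e hin w (by simpa using hw)
    · by_cases hne : ∃ e : G.edgeSet, ∀ v ∈ (e : Sym2 V), v ∈ S
      swap
      · obtain ⟨v⟩ := hS.nonempty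
        have hpos : (1 : ℝ) ≤ S.card := by
          exact_mod_cast (Finset.card_pos (s := S)).2 ⟨v, Finset.mem_coe.1 v.2⟩
        rw [Finset.filter_eq_empty_iff.2 fun e _ he => hne ⟨e, he⟩, Finset.sum_empty]
        linarith
      obtain ⟨p, hp, hSp, hr⟩ := hL S hS hne
      have hin : ∀ e : G.edgeSet, (∀ v ∈ (e : Sym2 V), v ∈ S) → ∀ v ∈ (e : Sym2 V), v ∈ p.1 :=
        fun e he v hv => hSp (he v hv)
      calc ∑ e ∈ Finset.univ.filter (fun e : G.edgeSet => ∀ v ∈ (e : Sym2 V), v ∈ S), x e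
          = ∑ e ∈ Finset.univ.filter (fun e : G.edgeSet => ∀ v ∈ (e : Sym2 V), v ∈ S),
              ∑ v ∈ Finset.univ.filter (fun v => v ∈ (e : Sym2 V)), y (⟨p, hp⟩, e, v) := by
            refine Finset.sum_congr rfl fun e he => hsum ⟨p, hp⟩ e (hin e ?_)
            simpa using he
        _ = ∑ v ∈ S, ∑ e ∈ Finset.univ.filter (fun e : G.edgeSet =>
              (∀ v ∈ (e : Sym2 V), v ∈ S) ∧ v ∈ (e : Sym2 V)), y (⟨p, hp⟩, e, v) := by
            refine Finset.sum_comm' fun e v => ?_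
            simp only [Finset.mem_filter, Finset.mem_univ, true_and]
            exact ⟨fun h => ⟨h, h.1 v h.2⟩, fun h => h.1⟩
        _ ≤ ∑ v ∈ S, if v = p.2 then (0 : ℝ) else 1 := by
            refine Finset.sum_le_sum fun v hv => ?_
            refine le_trans ?_ (hdeg ⟨p, hp⟩ v (hSp hv))
            refine Finset.sum_le_sum_of_subset_of_nonneg ?_ ?_
            · intro e he
              simp only [Finset.mem_filter, Finset.mem_univ, true_and] at he ⊢
              exact ⟨hin e he.1, he.2⟩
            · intro e he _
              simp only [Finset.mem_filter, Finset.mem_univ, true_and] at he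
              exact hnonneg ⟨p, hp⟩ e he.1 v he.2
        -- The root lies in `S`, which accounts for the `-1`.
        _ = S.card - 1 := by
            have h : ∀ v, (if v = p.2 then (0 : ℝ) else 1) = 1 - if v = p.2 then 1 else 0 := by
              intro v; split_ifs <;> norm_num
            simp [h, Finset.sum_sub_distrib, hr]

/-! ### Density and the final count -/

theorem card_filter_edges_le_ncard_induce [Finite V] (G : SimpleGraph V) [Fintype G.edgeSet]
    (S : Finset V) [DecidablePred fun e : G.edgeSet => ∀ v ∈ (e : Sym2 V), v ∈ S] :
    (Finset.univ.filter fun e : G.edgeSet => ∀ v ∈ (e : Sym2 V), v ∈ S).card ≤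
      (G.induce (S : Set V)).edgeSet.ncard := by
  classical
  rw [← Finset.card_image_of_injective _ (Subtype.val_injective : Function.Injective
    (Subtype.val : G.edgeSet → Sym2 V)), ← Set.ncard_coe_finset]
  refine le_trans (Set.ncard_le_ncard ?_ (Set.toFinite _))
    (Set.ncard_image_le (f := Sym2.map Subtype.val) (Set.toFinite _))
  intro e he
  simp only [Finset.coe_image, Finset.coe_filter, Finset.mem_univ, true_and, Set.mem_image] at he
  obtain ⟨⟨e, heG⟩, he, rfl⟩ := he
  induction e with | _ u v =>
  have he : ∀ w ∈ s(u, v), w ∈ S := he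
  exact ⟨s(⟨u, he u (Sym2.mem_mk_left _ _)⟩, ⟨v, he v (Sym2.mem_mk_right _ _)⟩), heG, rfl⟩

theorem ncard_edgeSet_le_of_density_le [Finite V] {G : SimpleGraph V} {d : ℝ}
    (h : G.density ≤ d) : (G.edgeSet.ncard : ℝ) ≤ d * Nat.card V := by
  rcases Nat.eq_zero_or_pos (Nat.card V) with h0 | h0
  · have : IsEmpty V := (Nat.card_eq_zero.1 h0).resolve_right (not_infinite_iff_finite.2 ‹_›)
    simp [Set.eq_empty_of_isEmpty G.edgeSet]
  · exact (div_le_iff₀ (by exact_mod_cast h0)).1 h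

/-- Forces `d ≥ 1/2` once some graph of the class has an edge, so that `|W| ≤ 2d|W|`. -/
theorem half_le_density_induce_pair [Finite V] {G : SimpleGraph V} {u v : V} (h : G.Adj u v) :
    1 / 2 ≤ (G.induce {u, v}).density := by
  have hc : Nat.card ({u, v} : Set V) = 2 := by
    rw [Nat.card_coe_set_eq, Set.ncard_pair h.ne]
  have he : 0 < (G.induce {u, v}).edgeSet.ncard := by
    rw [Set.ncard_pos]
    exact ⟨s(⟨u, by simp⟩, ⟨v, by simp⟩), h⟩
  have he' : (1 : ℝ) ≤ (G.induce {u, v}).edgeSet.ncard := by exact_mod_cast he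
  rw [density, hc]
  push_cast
  linarith

end SimpleGraph

theorem theorem3 (β : ℝ) (hβ0 : 0 < β) (hβ1 : β < 1) :
    ∃ K : ℝ, 0 < K ∧
      ∀ (𝒢 : GraphClass.{u}) (c d : ℝ), 𝒢.ClosedUnderInduced → 0 < c → 0 < d →
        (∀ {V : Type u} [Finite V] (G : SimpleGraph V), 𝒢.Mem G →
          G.density ≤ d ∧
          ∃ X : Set V, G.IsBalancedSeparator (1 / 2) X ∧
            (X.ncard : ℝ) ≤ c * (Nat.card V : ℝ) ^ β) →
        ∀ {V : Type u} [Finite V] (G : SimpleGraph V), 𝒢.Mem G →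
          ((extensionComplexity G.forestPolytope : ℕ∞) : ℝ≥0∞) ≤
            ENNReal.ofReal (K * c * d * (Nat.card V : ℝ) ^ (1 + β)) := by
  have h2 : (2 : ℝ) ^ (-β) < 1 := Real.rpow_lt_one_of_one_lt_of_neg one_lt_two (by linarith)
  have h2' : (0 : ℝ) < 1 - 2 ^ (-β) := by linarith
  -- The 4 comes from `2|E(G[W])| + |W| ≤ 2d|W| + 2d|W|`.
  refine ⟨4 / (1 - 2 ^ (-β)), by positivity, ?_⟩
  intro 𝒢 c d hind hc hd h𝒢 V _ G hG
  classical
  have : Fintype V := Fintype.ofFinite V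
  obtain ⟨L, hL, hLcard⟩ := SimpleGraph.exists_rooted_cover hc.le hβ0
    (fun W => (h𝒢 _ (hind G hG W)).2) Finset.univ
  have hK : ∀ b : ℕ, extensionComplexity G.forestPolytope ≤ (b : ℕ∞) →
      (b : ℝ) ≤ 4 / (1 - 2 ^ (-β)) * c * d * (Nat.card V : ℝ) ^ (1 + β) →
      ((extensionComplexity G.forestPolytope : ℕ∞) : ℝ≥0∞) ≤
        ENNReal.ofReal (4 / (1 - 2 ^ (-β)) * c * d * (Nat.card V : ℝ) ^ (1 + β)) := by
    intro b hb hb'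
    refine (ENat.toENNReal_mono hb).trans ?_
    rw [ENat.toENNReal_coe, ← ENNReal.ofReal_natCast]
    exact ENNReal.ofReal_le_ofReal hb'
  by_cases hE : ∃ u v, G.Adj u v
  swap
  -- Without edges `d` may be tiny, but then no pair is needed and the formulation has no
  -- inequalities.
  · refine hK _ (G.extensionComplexity_forestPolytope_le ∅ fun S _ ⟨⟨e, he⟩, _⟩ => ?_) ?_
    · induction e with | _ u v => exact absurd ⟨u, v, he⟩ hE
    · rw [Finset.sum_empty, Nat.cast_zero]
      positivity
  obtain ⟨u, v, huv⟩ := hE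
  have hd2 : 1 / 2 ≤ d :=
    (SimpleGraph.half_le_density_induce_pair huv).trans (h𝒢 _ (hind G hG _)).1
  refine hK _ (G.extensionComplexity_forestPolytope_le L fun S hS _ =>
    hL S (Finset.subset_univ S) hS) ?_
  have hterm : ∀ p ∈ L, ((2 * (Finset.univ.filter fun e : G.edgeSet =>
      ∀ v ∈ (e : Sym2 V), v ∈ p.1).card + p.1.card : ℕ) : ℝ) ≤ 4 * d * p.1.card := by
    intro p _
    have h1 : (((Finset.univ.filter fun e : G.edgeSet =>
        ∀ v ∈ (e : Sym2 V), v ∈ p.1).card : ℕ) : ℝ) ≤ _ :=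
      Nat.cast_le.2 (G.card_filter_edges_le_ncard_induce p.1)
    have h3 := h1.trans
      (SimpleGraph.ncard_edgeSet_le_of_density_le (h𝒢 _ (hind G hG (p.1 : Set V))).1)
    rw [show Nat.card (p.1 : Set V) = p.1.card by simp] at h3
    have h4 := mul_le_mul_of_nonneg_right hd2 (Nat.cast_nonneg (α := ℝ) p.1.card)
    push_cast
    linarith
  rw [Nat.cast_sum]
  calc _ ≤ ∑ p ∈ L, 4 * d * (p.1.card : ℝ) := Finset.sum_le_sum hterm
    _ = 4 * d * ∑ p ∈ L, (p.1.card : ℝ) := by rw [Finset.mul_sum]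
    _ ≤ 4 * d * (c / (1 - 2 ^ (-β)) * ((Finset.univ : Finset V).card : ℝ) ^ (1 + β)) :=
      mul_le_mul_of_nonneg_left hLcard (by positivity)
    _ = _ := by
      rw [Finset.card_univ, Nat.card_eq_fintype_card]
      ring
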